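/- A permutation on a finite poset $P$ with $N$ elements is a bijection $\sigma\colon\{1,\dots,N\}\to P$, written as the list $(\sigma_1,\dots,\sigma_N)$. For a poset $Q$ on $k$ elements and a permutation $\pi$ on $Q$ (a pattern), $\sigma$ contains $\pi$ if there are positions $i_1<\cdots<i_k$ such that for all $1\le a<b\le k$ the order relation (less than, greater than, or incomparable) between $\sigma_{i_a}$ and $\sigma_{i_b}$ is the same as that between $\pi_a$ and $\pi_b$; otherwise $\sigma$ avoids $\pi$. Let $Av_P(\pi)$ be the number of permutations on $P$ that avoid $\pi$. Two different patterns $\pi,\pi'$ (patterns being identified when an isomorphism of their posets carries one list to the other) are Wilf equivalent for $P$ if $Av_P(\pi)=Av_P(\pi')$. Let $\mathbb{B}_n$ be the Boolean lattice of all subsets of $\{1,\dots,n\}$ ordered by inclusion, and write $Av_n(\pi)=Av_{\mathbb{B}_n}(\pi)$. Let $123$ and $132$ denote the permutations $(1,2,3)$ and $(1,3,2)$ on the chain $\{1<2<3\}$. For every $n\ge 3$, $$Av_n(132)<Av_n(123).$$ In particular, the patterns $123$ and $132$ are not Wilf equivalent for $\mathbb{B}_n$ for any $n\ge 3$. -/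

import Mathlib

/-- A permutation on the finite poset `P`: a bijection from the set of positions
(here `0, …, |P| - 1`) to `P`, thought of as a list of the elements of `P`. -/
abbrev PosetPerm (P : Type*) [Fintype P] : Type _ := Fin (Fintype.card P) ≃ P

namespace PosetPerm

/-- `σ` contains the pattern `π`: there are entries of `σ` at increasing positions such that, for
all positions `a < b` of `π`, the order relation (less, greater or incomparable) between the
selected entries number `a` and `b` is the one between `π a` and `π b`. The entries of a permutation
are distinct, so agreement on "less" and on "greater" includes agreement on "incomparable". -/
def Contains {P Q : Type*} [PartialOrder P] [Fintype P] [PartialOrder Q] [Fintype Q]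
    (σ : PosetPerm P) (π : PosetPerm Q) : Prop :=
  ∃ i : Fin (Fintype.card Q) → Fin (Fintype.card P), StrictMono i ∧
    ∀ a b : Fin (Fintype.card Q), a < b →
      (σ (i a) < σ (i b) ↔ π a < π b) ∧ (σ (i b) < σ (i a) ↔ π b < π a)

/-- `σ` avoids the pattern `π`. -/
def Avoids {P Q : Type*} [PartialOrder P] [Fintype P] [PartialOrder Q] [Fintype Q]
    (σ : PosetPerm P) (π : PosetPerm Q) : Prop :=
  ¬ σ.Contains π

/-- `π` and `π'` are the same pattern: an isomorphism of the underlying posets carries the list `π`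
to the list `π'`. -/
def SamePattern {Q Q' : Type*} [PartialOrder Q] [Fintype Q] [PartialOrder Q'] [Fintype Q']
    (π : PosetPerm Q) (π' : PosetPerm Q') : Prop :=
  ∃ e : Q ≃o Q', ∀ (j : Fin (Fintype.card Q)) (j' : Fin (Fintype.card Q')),
    (j : ℕ) = (j' : ℕ) → e (π j) = π' j'

/-- A permutation of the chain with `k` elements, given by its list of values, as a pattern. -/
def ofPerm {k : ℕ} (τ : Equiv.Perm (Fin k)) : PosetPerm (Fin k) :=
  (finCongr (Fintype.card_fin k)).trans τ

/-- The pattern `123` (with values and positions counted from `0`: the list `0, 1, 2`). -/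
def pattern123 : PosetPerm (Fin 3) := ofPerm (Equiv.refl (Fin 3))

/-- The pattern `132` (with values and positions counted from `0`: the list `0, 2, 1`). -/
def pattern132 : PosetPerm (Fin 3) := ofPerm (Equiv.swap 1 2)

end PosetPerm

/-- The number of permutations on the finite poset `P` that avoid the pattern `π`. -/
noncomputable def avoidCount (P : Type*) [PartialOrder P] [Fintype P]
    {Q : Type*} [PartialOrder Q] [Fintype Q] (π : PosetPerm Q) : ℕ :=
  Nat.card {σ : PosetPerm P // σ.Avoids π}

/-- Two different patterns are Wilf equivalent for `P` if equally many permutations on `P`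
avoid them. -/
def WilfEquivalent (P : Type*) [PartialOrder P] [Fintype P]
    {Q Q' : Type*} [PartialOrder Q] [Fintype Q] [PartialOrder Q'] [Fintype Q']
    (π : PosetPerm Q) (π' : PosetPerm Q') : Prop :=
  ¬ π.SamePattern π' ∧ avoidCount P π = avoidCount P π'

/-- The Boolean lattice: all subsets of an `n`-element set, ordered by inclusion. -/
abbrev BooleanLattice (n : ℕ) : Type := Finset (Fin n)

/-!
Call a letter of a word over a poset *high* if it lies above an earlier letter. A word avoids `123`
exactly when its high letters never increase, and avoids `132` exactly when no letter larger than
`b` stands between a letter below `b` and `b` itself. The Simion–Schmidt map keeps the other letters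
fixed and rearranges the high ones: running through the word from the right, it slides every high
letter into the remainder by carrying a letter from the right end back to the front and exchanging
the carried letter with each larger one met, so that the letter that arrives at the front is
maximal. On words avoiding `132`, a slide is undone by carrying the front letter rightwards and
exchanging the carried letter with each smaller one that lies above a letter preceding the
remainder. Hence at least as many permutations avoid `123` as `132`.

The inequality is strict as soon as there are `a < b < t` and `d < c < t` such that `t` is the only
`y` with `a < y` and `c ≤ y` (in a Boolean algebra, `c = aᶜ` and `t = ⊤`). List `a`, then `t`, then
the elements not above `a` without increasing pairs except that `c` is put last, then the elements
above `a` without increasing pairs. This word avoids `123`. In a preimage, `t` would have been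
carried leftwards past `c` to reach the second place, so before that slide the remainder would
contain `d, c, t` in this order; but that remainder is itself an image, so it avoids `123`.
-/

namespace PatternAvoidance

open List

section Words

variable {α : Type*} [PartialOrder α] {U : Set α}

/-- Relative avoidance of `123`: the word `l` has no subword `a, b, c` with `a < b < c`, and no
subword `b, c` with `b < c` and `b ∈ U`. The set `U` stands for the elements that lie above some
letter already read, so that `Avoids123 ∅` is avoidance of the pattern. -/
def Avoids123 (U : Set α) (l : List α) : Prop :=
  l.Pairwise (fun b c => b ∈ U → ¬ b < c) ∧ l.Triplewise (fun a b c => a < b → ¬ b < c)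

/-- Relative avoidance of `132`: the word `l` has no subword `a, c, b` with `a < b < c`, and no
subword `c, b` with `b < c` and `b ∈ U`. See `Avoids123` for the role of `U`. -/
def Avoids132 (U : Set α) (l : List α) : Prop :=
  l.Pairwise (fun c b => b ∈ U → ¬ b < c) ∧ l.Triplewise (fun a c b => a < b → ¬ b < c)

theorem avoids123_nil : Avoids123 U [] := ⟨.nil, .nil⟩

theorem avoids123_cons {x : α} {l : List α} :
    Avoids123 U (x :: l) ↔ (x ∈ U → ∀ y ∈ l, ¬ x < y) ∧ Avoids123 (U ∪ Set.Ioi x) l := by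
  simp only [Avoids123, pairwise_cons, triplewise_cons, Set.mem_union, Set.mem_Ioi, or_imp,
    pairwise_and_iff]
  tauto

theorem avoids132_cons {x : α} {l : List α} :
    Avoids132 U (x :: l) ↔ (∀ y ∈ l, y ∈ U → ¬ y < x) ∧ Avoids132 (U ∪ Set.Ioi x) l := by
  simp only [Avoids132, pairwise_cons, triplewise_cons, Set.mem_union, Set.mem_Ioi, or_imp,
    pairwise_and_iff]
  tauto

theorem avoids123_empty {l : List α} :
    Avoids123 ∅ l ↔ l.Triplewise fun a b c => a < b → ¬ b < c :=
  and_iff_right (pairwise_of_forall fun _ _ h => h.elim)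

theorem avoids132_empty {l : List α} :
    Avoids132 ∅ l ↔ l.Triplewise fun a c b => a < b → ¬ b < c :=
  and_iff_right (pairwise_of_forall fun _ _ h => h.elim)

theorem union_Ioi_eq_self (hU : IsUpperSet U) {x : α} (hx : x ∈ U) : U ∪ Set.Ioi x = U :=
  Set.union_eq_left.2 (hU.Ioi_subset hx)

open Classical in
/-- Read the word from right to left, carrying a letter, initially `x`, and exchange the carried
letter with every larger letter met. The result consists of the last carried letter and the new
word. -/
noncomputable def slide (x : α) : List α → α × List α
  | [] => (x, [])
  | y :: l =>
    if (slide x l).1 < y then (y, (slide x l).1 :: (slide x l).2)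
    else ((slide x l).1, y :: (slide x l).2)

open Classical in
/-- Read the word from left to right, carrying a letter, initially `x`, and exchange the carried
letter with every smaller letter of `U` met. This undoes `slide`; see `unslide_slide`. -/
noncomputable def unslide (U : Set α) (x : α) : List α → α × List α
  | [] => (x, [])
  | y :: l =>
    if y < x ∧ y ∈ U then ((unslide U y l).1, x :: (unslide U y l).2)
    else ((unslide U x l).1, y :: (unslide U x l).2)

theorem slide_perm (x : α) (l : List α) : (slide x l).1 :: (slide x l).2 ~ x :: l := by
  induction l with
  | nil => exact .refl _
  | cons y l ih =>
    have hcons : y :: (slide x l).1 :: (slide x l).2 ~ x :: y :: l :=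
      (ih.cons y).trans (.swap _ _ _)
    rw [slide]
    split_ifs
    · exact hcons
    · exact (Perm.swap _ _ _).trans hcons

theorem le_slide_fst (x : α) (l : List α) : x ≤ (slide x l).1 := by
  induction l with
  | nil => exact le_rfl
  | cons y l ih =>
    rw [slide]
    split_ifs with hy
    · exact ih.trans hy.le
    · exact ih

theorem not_slide_fst_lt (x : α) (l : List α) : ∀ z ∈ (slide x l).2, ¬ (slide x l).1 < z := by
  induction l with
  | nil => exact fun z hz => absurd hz not_mem_nil
  | cons y l ih =>
    rw [slide]
    split_ifs with hy
    · exact forall_mem_cons.2 ⟨hy.asymm, fun z hz hyz => ih z hz (hy.trans hyz)⟩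
    · exact forall_mem_cons.2 ⟨hy, ih⟩

theorem exists_le_of_mem_slide_snd {x z : α} {l : List α} (hz : z ∈ (slide x l).2) :
    ∃ y ∈ l, z ≤ y := by
  induction l with
  | nil => exact absurd hz not_mem_nil
  | cons y l ih =>
    rw [slide] at hz
    split_ifs at hz with hy <;> rcases mem_cons.1 hz with rfl | hz
    · exact ⟨y, mem_cons_self, hy.le⟩
    · exact exists_mem_cons_of_exists (ih hz)
    · exact ⟨z, mem_cons_self, le_rfl⟩
    · exact exists_mem_cons_of_exists (ih hz)

theorem unslide_slide {x : α} {l : List α} (hU : IsUpperSet U) (hx : x ∈ U)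
    (hmin : ∀ y ∈ l, y ∈ U → ¬ y < x) (hl : l.Pairwise fun y z => y ∈ U → ¬ y < z) :
    unslide U (slide x l).1 (slide x l).2 = (x, l) := by
  induction l with
  | nil => rfl
  | cons y l ih =>
    rw [pairwise_cons] at hl
    rw [forall_mem_cons] at hmin
    specialize ih hmin.2 hl.2
    rw [slide]
    split_ifs with hy
    · rw [unslide, if_pos ⟨hy, hU (le_slide_fst x l) hx⟩, ih]
    · have hstay : ¬ (y < (slide x l).1 ∧ y ∈ U) := by
        rintro ⟨hlt, hyU⟩
        rcases mem_cons.1 ((slide_perm x l).subset mem_cons_self) with hs | hs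
        · exact hmin.1 hyU (hs ▸ hlt)
        · exact hl.1 _ hs hyU hlt
      rw [unslide, if_neg hstay, ih]

theorem avoids123_slide_snd {x : α} {l : List α} (hU : IsUpperSet U) (hx : x ∈ U)
    (hl : Avoids123 U l) : Avoids123 U (slide x l).2 := by
  induction l generalizing U with
  | nil => exact hl
  | cons y l ih =>
    rw [avoids123_cons] at hl
    rw [slide]
    split_ifs with hy
    · have hsU : (slide x l).1 ∈ U := hU (le_slide_fst x l) hx
      rw [union_Ioi_eq_self hU (hU hy.le hsU)] at hl
      rw [avoids123_cons, union_Ioi_eq_self hU hsU]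
      exact ⟨fun _ => not_slide_fst_lt x l, ih hU hx hl.2⟩
    · refine avoids123_cons.2 ⟨fun hyU z hz hyz => ?_,
        ih (hU.union (isUpperSet_Ioi y)) (Or.inl hx) hl.2⟩
      obtain ⟨w, hw, hzw⟩ := exists_le_of_mem_slide_snd hz
      exact hl.1 hyU w hw (hyz.trans_le hzw)

open Classical in
/-- The Simion–Schmidt map from words avoiding `132` to words avoiding `123`, for words over a
poset: the letters that are not high, that is, neither in `U` nor above an earlier letter, keep
their places, and the high letters are slid in from right to left. -/
noncomputable def simionSchmidt (U : Set α) : List α → List α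
  | [] => []
  | x :: l =>
    if x ∈ U then (slide x (simionSchmidt U l)).1 :: (slide x (simionSchmidt U l)).2
    else x :: simionSchmidt (U ∪ Set.Ioi x) l

theorem simionSchmidt_cons_of_mem {x : α} (hx : x ∈ U) (l : List α) :
    simionSchmidt U (x :: l) =
      (slide x (simionSchmidt U l)).1 :: (slide x (simionSchmidt U l)).2 :=
  if_pos hx

theorem simionSchmidt_cons_of_notMem {x : α} (hx : x ∉ U) (l : List α) :
    simionSchmidt U (x :: l) = x :: simionSchmidt (U ∪ Set.Ioi x) l :=
  if_neg hx

theorem simionSchmidt_perm (U : Set α) (l : List α) : simionSchmidt U l ~ l := by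
  induction l generalizing U with
  | nil => exact .refl _
  | cons x l ih =>
    by_cases hx : x ∈ U
    · rw [simionSchmidt_cons_of_mem hx]
      exact (slide_perm _ _).trans ((ih U).cons x)
    · rw [simionSchmidt_cons_of_notMem hx]
      exact (ih _).cons x

theorem avoids123_simionSchmidt (hU : IsUpperSet U) (l : List α) :
    Avoids123 U (simionSchmidt U l) := by
  induction l generalizing U with
  | nil => exact avoids123_nil
  | cons x l ih =>
    by_cases hx : x ∈ U
    · have hs : (slide x (simionSchmidt U l)).1 ∈ U := hU (le_slide_fst _ _) hx
      rw [simionSchmidt_cons_of_mem hx, avoids123_cons, union_Ioi_eq_self hU hs]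
      exact ⟨fun _ => not_slide_fst_lt _ _, avoids123_slide_snd hU hx (ih hU)⟩
    · rw [simionSchmidt_cons_of_notMem hx, avoids123_cons]
      exact ⟨fun hxU => absurd hxU hx, ih (hU.union (isUpperSet_Ioi x))⟩

theorem head_mem_iff_of_simionSchmidt_eq {x y : α} {l r : List α} (hU : IsUpperSet U)
    (h : simionSchmidt U (x :: l) = y :: r) : x ∈ U ↔ y ∈ U := by
  by_cases hx : x ∈ U
  · rw [simionSchmidt_cons_of_mem hx, cons.injEq] at h
    exact iff_of_true hx (h.1 ▸ hU (le_slide_fst _ _) hx)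
  · rw [simionSchmidt_cons_of_notMem hx, cons.injEq] at h
    rw [h.1]

theorem unslide_of_simionSchmidt_eq {x y : α} {l r : List α} (hU : IsUpperSet U) (hx : x ∈ U)
    (hl : Avoids132 U (x :: l)) (h : simionSchmidt U (x :: l) = y :: r) :
    unslide U y r = (x, simionSchmidt U l) := by
  rw [simionSchmidt_cons_of_mem hx, cons.injEq] at h
  rw [← h.1, ← h.2]
  exact unslide_slide hU hx
    (fun z hz => (avoids132_cons.1 hl).1 z ((simionSchmidt_perm U l).subset hz))
    (avoids123_simionSchmidt hU l).1

theorem injOn_simionSchmidt (hU : IsUpperSet U) :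
    Set.InjOn (simionSchmidt U) {l | Avoids132 U l} := by
  intro l hl m hm h
  have hperm : l ~ m :=
    (simionSchmidt_perm U l).symm.trans (h ▸ simionSchmidt_perm U m)
  induction l generalizing U m with
  | nil => exact hperm.nil_eq
  | cons x l ih =>
    obtain _ | ⟨y, m⟩ := m
    · exact hperm.eq_nil
    have hl' : Avoids132 (U ∪ Set.Ioi x) l := (avoids132_cons.1 hl).2
    have hm' : Avoids132 (U ∪ Set.Ioi y) m := (avoids132_cons.1 hm).2
    by_cases hx : x ∈ U
    · have hlimage := simionSchmidt_cons_of_mem hx l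
      have hmimage := h.symm.trans hlimage
      have hy : y ∈ U :=
        (head_mem_iff_of_simionSchmidt_eq hU hmimage).2 (hU (le_slide_fst _ _) hx)
      obtain ⟨rfl, htail⟩ : x = y ∧ simionSchmidt U l = simionSchmidt U m :=
        Prod.mk.inj ((unslide_of_simionSchmidt_eq hU hx hl hlimage).symm.trans
          (unslide_of_simionSchmidt_eq hU hy hm hmimage))
      rw [union_Ioi_eq_self hU hx] at hl' hm'
      rw [ih hU hl' hm' htail hperm.cons_inv]
    · have hlimage := simionSchmidt_cons_of_notMem hx l
      have hy : y ∉ U := by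
        rwa [head_mem_iff_of_simionSchmidt_eq hU (h.symm.trans hlimage)]
      rw [hlimage, simionSchmidt_cons_of_notMem hy, cons.injEq] at h
      obtain ⟨rfl, htail⟩ := h
      rw [ih (hU.union (isUpperSet_Ioi x)) hl' hm' htail hperm.cons_inv]

theorem unslide_append {l : List α} (hl : ∀ y ∈ l, y ∉ U) (x : α) (m : List α) :
    unslide U x (l ++ m) = ((unslide U x m).1, l ++ (unslide U x m).2) := by
  induction l with
  | nil => rfl
  | cons y l ih =>
    rw [forall_mem_cons] at hl
    rw [cons_append, unslide, if_neg fun h => hl.1 h.2, ih hl.2, cons_append]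

theorem mem_unslide_snd {x y : α} {l : List α} (hy : y ∈ l) (hyU : y ∈ U) (hyx : y < x) :
    x ∈ (unslide U x l).2 := by
  induction l with
  | nil => exact absurd hy not_mem_nil
  | cons z l ih =>
    rw [unslide]
    split_ifs with hz
    · exact mem_cons_self
    · rcases mem_cons.1 hy with rfl | hy
      · exact absurd ⟨hyx, hyU⟩ hz
      · exact mem_cons_of_mem _ (ih hy)

theorem simionSchmidt_ne {a b c d t : α} {e f l : List α} (hab : a < b) (hbt : b < t)
    (hdc : d < c) (hct : c < t) (hac : ¬ a < c) (he : ∀ y ∈ e, ¬ a < y) (hd : d ∈ e) (hb : b ∈ f)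
    (hl : Avoids132 ∅ l) : simionSchmidt ∅ l ≠ a :: t :: (e ++ c :: f) := by
  intro h
  have hU : IsUpperSet (Set.Ioi a) := isUpperSet_Ioi a
  obtain _ | ⟨x, l⟩ := l
  · cases h
  rw [simionSchmidt_cons_of_notMem (Set.notMem_empty x), cons.injEq, Set.empty_union] at h
  obtain ⟨rfl, h⟩ := h
  obtain _ | ⟨y, l⟩ := l
  · cases h
  have hl' : Avoids132 (Set.Ioi x) (y :: l) :=
    Set.empty_union (Set.Ioi x) ▸ (avoids132_cons.1 hl).2
  have hy : y ∈ Set.Ioi x := (head_mem_iff_of_simionSchmidt_eq hU h).2 (hab.trans hbt)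
  have hunslide := unslide_of_simionSchmidt_eq hU hy hl' h
  rw [unslide_append (U := Set.Ioi x) he, unslide, if_neg fun hc => hac hc.2,
    Prod.mk.injEq] at hunslide
  have htriple := (hunslide.2 ▸ avoids123_simionSchmidt hU l).2
  have hct' := pairwise_cons.1 ((triplewise_append.1 htriple).2.2.1 d hd)
  exact hct'.1 t (mem_unslide_snd hb hab hbt) hdc hct

theorem triplewise_not_lt_of_pairwise_not_lt {l : List α} (hl : l.Pairwise fun x y => ¬ x < y) :
    l.Triplewise fun x y z => x < y → ¬ y < z := by
  induction hl with
  | nil => exact .nil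
  | cons _ hl ih => exact .cons (hl.imp fun h _ hlt => h hlt) ih

theorem triplewise_append_of_pairwise_not_lt {l m : List α} (hl : l.Pairwise fun x y => ¬ x < y)
    (hm : m.Pairwise fun x y => ¬ x < y) : (l ++ m).Triplewise fun x y z => x < y → ¬ y < z :=
  triplewise_append.2 ⟨triplewise_not_lt_of_pairwise_not_lt hl,
    triplewise_not_lt_of_pairwise_not_lt hm, fun _ _ => hm.imp fun h _ hlt => h hlt,
    fun _ _ => hl.imp fun h hxy => absurd hxy h⟩

theorem avoids123_cons_cons_append {a t : α} {l m : List α} (ht : IsMax t)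
    (hal : ∀ y ∈ l, ¬ a < y) (hl : l.Pairwise fun x y => ¬ x < y)
    (hm : m.Pairwise fun x y => ¬ x < y) : Avoids123 ∅ (a :: t :: (l ++ m)) := by
  rw [avoids123_cons, avoids123_cons, Set.empty_union, ht.Ioi_eq, Set.union_empty]
  refine ⟨fun ha => ha.elim, fun _ y _ => ht.not_lt, pairwise_append.2 ⟨?_, ?_, ?_⟩,
    triplewise_append_of_pairwise_not_lt hl hm⟩
  · exact hl.imp fun h _ hlt => h hlt
  · exact hm.imp fun h _ hlt => h hlt
  · exact fun y hy z _ hay => absurd hay (hal y hy)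

theorem exists_nodup_pairwise_not_lt (α : Type*) [PartialOrder α] [Finite α] :
    ∃ l : List α, l.Nodup ∧ (∀ x, x ∈ l) ∧ l.Pairwise fun x y => ¬ x < y := by
  classical
  have := Fintype.ofFinite α
  obtain ⟨r, hr, hle⟩ := extend_partialOrder (α := α) (· ≥ ·)
  refine ⟨Finset.univ.sort r, Finset.sort_nodup _ r, fun x => ?_, ?_⟩
  · exact (Finset.mem_sort r).2 (Finset.mem_univ x)
  · exact (Finset.pairwise_sort _ r).imp fun hxy hlt =>
      hlt.ne (antisymm (r := r) hxy (hle _ _ hlt.le))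

/-- The words in which every element of `P` occurs exactly once. -/
def listings (P : Type*) : Set (List P) := {l | l.Nodup ∧ ∀ x, x ∈ l}

theorem simionSchmidt_mem_listings {l : List α} (hl : l ∈ listings α) :
    simionSchmidt U l ∈ listings α :=
  have h := simionSchmidt_perm U l
  ⟨h.nodup_iff.2 hl.1, fun x => h.mem_iff.2 (hl.2 x)⟩

theorem exists_avoids123_notMem_image_simionSchmidt [Finite α] {a b c d t : α} (hab : a < b)
    (hbt : b < t) (hdc : d < c) (hct : c < t) (hac : ∀ y, a < y → c ≤ y → y = t) :
    ∃ w ∈ listings α, Avoids123 ∅ w ∧ w ∉ simionSchmidt ∅ '' {l | Avoids132 ∅ l} := by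
  classical
  obtain ⟨l, hnodup, hmem, hdec⟩ := exists_nodup_pairwise_not_lt α
  have ht : IsMax t := fun y hty =>
    (hac y ((hab.trans hbt).trans_le hty) (hct.le.trans hty)).le
  have hnac : ¬ a < c := fun h => hct.ne (hac c h le_rfl)
  have hne : a ≠ c := fun h => hbt.ne (hac b hab (h ▸ hab.le))
  let e := l.filter fun y => ¬ a < y ∧ y ≠ a ∧ y ≠ c
  let f := l.filter fun y => a < y ∧ y ≠ t
  have hmem_e (y : α) : y ∈ e ↔ ¬ a < y ∧ y ≠ a ∧ y ≠ c := by simp [e, hmem]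
  have hmem_f (y : α) : y ∈ f ↔ a < y ∧ y ≠ t := by simp [f, hmem]
  have hd : d ∈ e := (hmem_e d).2
    ⟨fun h => hnac (h.trans hdc), fun h => hnac (h ▸ hdc), hdc.ne⟩
  have hcf : (c :: f).Pairwise fun x y => ¬ x < y :=
    pairwise_cons.2 ⟨fun y hy hcy => ((hmem_f y).1 hy).2 (hac y ((hmem_f y).1 hy).1 hcy.le),
      hdec.filter _⟩
  have he : ∀ y ∈ e, ¬ a < y := fun y hy => ((hmem_e y).1 hy).1
  refine ⟨a :: t :: (e ++ c :: f), ⟨?_, fun y => ?_⟩,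
    avoids123_cons_cons_append ht he (hdec.filter _) hcf, ?_⟩
  · have hat : a ≠ t := (hab.trans hbt).ne
    have hnodup_e : e.Nodup := hnodup.filter _
    have hnodup_f : f.Nodup := hnodup.filter _
    simp only [nodup_cons, nodup_append, mem_cons, mem_append, hmem_e, hmem_f]
    grind
  · simp only [mem_cons, mem_append, hmem_e, hmem_f]
    tauto
  · rintro ⟨m, hm, h⟩
    exact simionSchmidt_ne hab hbt hdc hct hnac he hd ((hmem_f b).2 ⟨hab, hbt.ne⟩) hm h

end Words

section Permutations

theorem range_ofFn_eq_listings (P : Type*) [Fintype P] :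
    Set.range (fun σ : PosetPerm P => ofFn σ) = listings P := by
  classical
  ext l
  constructor
  · rintro ⟨σ, rfl⟩
    exact ⟨nodup_ofFn.2 σ.injective, fun x => mem_ofFn.2 (σ.surjective x)⟩
  · rintro ⟨hnodup, hmem⟩
    let e : Fin l.length ≃ P := hnodup.getEquivOfForallMemList l hmem
    have hcard : Fintype.card P = l.length := by simpa using (Fintype.card_congr e).symm
    exact ⟨(finCongr hcard).trans e, ext_getElem (by simp [hcard]) fun i _ _ => by simp [e]⟩

theorem finite_listings (P : Type*) [Finite P] : (listings P).Finite :=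
  have := Fintype.ofFinite P
  range_ofFn_eq_listings P ▸ Set.finite_range _

theorem triplewise_ofFn {α : Type*} {n : ℕ} {f : Fin n → α} {p : α → α → α → Prop} :
    (ofFn f).Triplewise p ↔ ∀ i j k, i < j → j < k → p (f i) (f j) (f k) := by
  simp only [triplewise_iff_getElem, List.getElem_ofFn, length_ofFn]
  exact ⟨fun h i j k hij hjk => h i j k hij hjk k.2,
    fun h i j k hij hjk hk => h ⟨i, _⟩ ⟨j, _⟩ ⟨k, hk⟩ hij hjk⟩

theorem strictMono_fin_three_iff {β : Type*} [Preorder β] {f : Fin 3 → β} :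
    StrictMono f ↔ f 0 < f 1 ∧ f 1 < f 2 := by
  rw [Fin.strictMono_iff_lt_succ, Fin.forall_fin_two]
  rfl

variable {P : Type*} [PartialOrder P] [Fintype P]

/- Since the values of `τ` are pairwise comparable, `σ` need only preserve, not reflect, their
order. -/
theorem contains_ofPerm_iff {k : ℕ} {σ : PosetPerm P} {τ : Equiv.Perm (Fin k)} :
    σ.Contains (PosetPerm.ofPerm τ) ↔
      ∃ i : Fin k → Fin (Fintype.card P), StrictMono i ∧ StrictMono (σ ∘ i ∘ τ.symm) := by
  let e := Fin.castOrderIso (Fintype.card_fin k)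
  have hofPerm : ⇑(PosetPerm.ofPerm τ) = τ ∘ e := rfl
  constructor
  · rintro ⟨i, hi, h⟩
    refine ⟨i ∘ e.symm, hi.comp e.symm.strictMono, fun x y hxy => ?_⟩
    have hpos : e.symm (τ.symm x) ≠ e.symm (τ.symm y) := by simpa using hxy.ne
    rcases hpos.lt_or_gt with hlt | hlt
    · exact (h _ _ hlt).1.2 (by simpa [hofPerm] using hxy)
    · exact (h _ _ hlt).2.2 (by simpa [hofPerm] using hxy)
  · rintro ⟨i, hi, h⟩
    have hmono {x y : Fin (Fintype.card (Fin k))} (hxy : τ (e x) < τ (e y)) :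
        σ (i (e x)) < σ (i (e y)) := by simpa using h hxy
    refine ⟨i ∘ e, hi.comp e.strictMono, fun x y hxy => ?_⟩
    have hval : τ (e x) ≠ τ (e y) := by simpa using hxy.ne
    rcases hval.lt_or_gt with hlt | hlt
    · exact ⟨iff_of_true (hmono hlt) hlt, iff_of_false (hmono hlt).asymm hlt.asymm⟩
    · exact ⟨iff_of_false (hmono hlt).asymm hlt.asymm, iff_of_true (hmono hlt) hlt⟩

theorem avoids_pattern123_iff {σ : PosetPerm P} :
    σ.Avoids PosetPerm.pattern123 ↔ Avoids123 ∅ (ofFn σ) := by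
  rw [avoids123_empty, triplewise_ofFn, PosetPerm.Avoids, PosetPerm.pattern123,
    contains_ofPerm_iff]
  simp only [strictMono_fin_three_iff]
  constructor
  · exact fun h i j k hij hjk hσij hσjk => h ⟨![i, j, k], ⟨hij, hjk⟩, hσij, hσjk⟩
  · exact fun h ⟨i, hi, hσ⟩ => h _ _ _ hi.1 hi.2 hσ.1 hσ.2

theorem avoids_pattern132_iff {σ : PosetPerm P} :
    σ.Avoids PosetPerm.pattern132 ↔ Avoids132 ∅ (ofFn σ) := by
  rw [avoids132_empty, triplewise_ofFn, PosetPerm.Avoids, PosetPerm.pattern132,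
    contains_ofPerm_iff]
  simp only [strictMono_fin_three_iff]
  constructor
  · exact fun h i j k hij hjk hσik hσkj => h ⟨![i, j, k], ⟨hij, hjk⟩, hσik, hσkj⟩
  · exact fun h ⟨i, hi, hσ⟩ => h _ _ _ hi.1 hi.2 hσ.1 hσ.2

theorem avoidCount_eq_ncard {Q : Type*} [PartialOrder Q] [Fintype Q] {π : PosetPerm Q}
    {p : List P → Prop} (h : ∀ σ : PosetPerm P, σ.Avoids π ↔ p (ofFn σ)) :
    avoidCount P π = (listings P ∩ {l | p l}).ncard := by
  have hinj : Function.Injective fun σ : PosetPerm P => ofFn σ :=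
    ofFn_injective.comp DFunLike.coe_injective
  have hset : {σ : PosetPerm P | σ.Avoids π} = (fun σ : PosetPerm P => ofFn σ) ⁻¹' {l | p l} :=
    Set.ext h
  rw [← range_ofFn_eq_listings, ← Set.image_preimage_eq_range_inter, ← hset,
    Set.ncard_image_of_injective _ hinj]
  rfl

theorem avoidCount_pattern132_lt_of_notMem_image {w : List P} (hw : w ∈ listings P)
    (hw123 : Avoids123 ∅ w) (hwimage : w ∉ simionSchmidt ∅ '' {l | Avoids132 ∅ l}) :
    avoidCount P PosetPerm.pattern132 < avoidCount P PosetPerm.pattern123 := by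
  have hinj : Set.InjOn (simionSchmidt ∅) (listings P ∩ {l | Avoids132 ∅ l}) :=
    (injOn_simionSchmidt isUpperSet_empty).mono Set.inter_subset_right
  have himage : simionSchmidt ∅ '' (listings P ∩ {l | Avoids132 ∅ l}) ⊂
      listings P ∩ {l | Avoids123 ∅ l} := by
    refine (Set.ssubset_iff_of_subset ?_).2
      ⟨w, ⟨hw, hw123⟩, fun h => hwimage (Set.image_mono Set.inter_subset_right h)⟩
    rintro _ ⟨l, ⟨hl, -⟩, rfl⟩
    exact ⟨simionSchmidt_mem_listings hl, avoids123_simionSchmidt isUpperSet_empty l⟩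
  rw [avoidCount_eq_ncard fun _ => avoids_pattern132_iff,
    avoidCount_eq_ncard fun _ => avoids_pattern123_iff, ← hinj.ncard_image]
  exact Set.ncard_lt_ncard himage ((finite_listings P).inter_of_left _)

end Permutations

theorem exists_bot_lt_lt_lt_top {α : Type*} [Fintype α] (h : 2 < Fintype.card α) :
    ∃ a b : Finset α, ⊥ < a ∧ a < b ∧ b < ⊤ := by
  classical
  obtain ⟨x, y, z, hxy, hxz, hyz⟩ := Fintype.two_lt_card_iff.1 h
  refine ⟨{x}, {x, y}, ?_, ?_, ?_⟩
  · exact bot_lt_iff_ne_bot.2 (Finset.singleton_ne_empty x)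
  · exact (Finset.ssubset_iff_of_subset (by simp)).2 ⟨y, by simp, by simpa using hxy.symm⟩
  · exact lt_top_iff_ne_top.2 fun htop => by
      simpa [hxz.symm, hyz.symm] using htop.ge (Finset.mem_univ z)

end PatternAvoidance

open PatternAvoidance

theorem mainTheorem2_general {P : Type*} [PartialOrder P] [Fintype P] {a b c d t : P}
    (hab : a < b) (hbt : b < t) (hdc : d < c) (hct : c < t)
    (hac : ∀ y, a < y → c ≤ y → y = t) :
    avoidCount P PosetPerm.pattern132 < avoidCount P PosetPerm.pattern123 ∧
      ¬ WilfEquivalent P PosetPerm.pattern123 PosetPerm.pattern132 := by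
  obtain ⟨w, hw, hw123, hwimage⟩ :=
    exists_avoids123_notMem_image_simionSchmidt hab hbt hdc hct hac
  have hlt := avoidCount_pattern132_lt_of_notMem_image hw hw123 hwimage
  exact ⟨hlt, fun hwilf => hlt.ne' hwilf.2⟩

theorem mainTheorem2 (n : ℕ) (hn : 3 ≤ n) :
    avoidCount (BooleanLattice n) PosetPerm.pattern132 <
        avoidCount (BooleanLattice n) PosetPerm.pattern123 ∧
      ¬ WilfEquivalent (BooleanLattice n) PosetPerm.pattern123 PosetPerm.pattern132 := by
  obtain ⟨a, b, ha, hab, hb⟩ := exists_bot_lt_lt_lt_top (α := Fin n) (by simpa)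
  exact mainTheorem2_general hab hb (compl_lt_compl_iff_lt.2 hab)
    (lt_top_iff_ne_top.2 <| by simpa using ha.ne')
    fun y hay hac => top_le_iff.1 (isCompl_compl.codisjoint hay.le hac)
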